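/- Let $n,m\in\mathbb N$ with $m\ge 1$, let $F=(F_1,\dots,F_m):\mathbb R^n\to\mathbb R^m$ and $x^0\in\mathbb R^n$. Write $u\preceq v$ for the componentwise order, $\|\cdot\|$ for the Euclidean norm, $\Delta_m$ for the unit simplex $\{\mu\in\mathbb R^m:\mu\succeq 0,\ \sum_j\mu_j=1\}$, and $\mathcal D(x,d)=\max_{j}\nabla F_j(x)^\top d$. A point $x$ is *Pareto critical* if there is no $d\in\mathbb R^n$ with $\nabla F_j(x)^\top d<0$ for all $j$, and *Pareto optimal* if there is no $y\in\mathbb R^n$ with $F(y)\preceq F(x)$ and $F(y)\ne F(x)$. Assume that $F$ is continuously differentiable, that the level set $\mathcal L=\{x: F(x)\preceq F(x^0)\}$ is bounded, and that there are $L\ge 0$ and an open set $\mathcal N\supseteq\mathcal L$ on which every $\nabla F_j$ is $L$-Lipschitz continuous. Let $\rho\in(0,1/2)$, $\sigma\in(\rho,1)$, $0<\underline\vartheta\le\bar\vartheta$, and let $B_1^0,\dots,B_m^0\in\mathbb R^{n\times n}$ be symmetric positive definite. Let $\{x^k\}_{k\ge 0}$ be an infinite sequence generated from $x^0$ by the following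 algorithm (so that no $x^k$ is Pareto critical, since the algorithm stops at a Pareto critical iterate). For $k=0,1,2,\dots$: 1. $d^k=\operatorname{arg\,min}_{d\in\mathbb R^n}\max_{j}\big(\nabla F_j(x^k)^\top d+\tfrac12 d^\top B_j^k d\big)$. 2. If $x^k$ is Pareto critical, stop. 3. Choose any $\alpha_k>0$ with $F_j(x^k+\alpha_kd^k)\le F_j(x^k)+\rho\,\alpha_k\,\mathcal D(x^k,d^k)$ for all $j$ and $\mathcal D(x^k+\alpha_kd^k,d^k)\ge\sigma\,\mathcal D(x^k,d^k)$, and set $x^{k+1}=x^k+\alpha_kd^k$. 4. Put $s^k=x^{k+1}-x^k$, $y_j^k=\nabla F_j(x^{k+1})-\nabla F_j(x^k)$, $\eta_j^k=(y_j^k)^\top s^k/\|s^k\|^2$. Choose any $\mu^k\in\Delta_m$ and $\vartheta_k\in(\underline\vartheta,\bar\vartheta)$, and put $r_j^k=\max\{-\eta_j^k,0\}+\vartheta_k\big\|\sum_{i}\mu_i^k\nabla F_i(x^k)\big\|$ and $\gamma_j^k=y_j^k+r_j^ks^k$ for all $j$. 5. For all $j$, set $$B_j^{k+1}=B_j^k-\frac{B_j^ks^k(s^k)^\top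 B_j^k}{(s^k)^\top B_j^ks^k}+\frac{\gamma_j^k(\gamma_j^k)^\top}{(\gamma_j^k)^\top s^k}.$$ If $F$ is strictly convex, that is, $F_j((1-t)x+ty)<(1-t)F_j(x)+tF_j(y)$ for all $j$, all $x\ne y$ in $\mathbb R^n$ and all $t\in(0,1)$, then the whole sequence $\{x^k\}$ converges to a Pareto optimal point of $F$. -/

import Mathlib

open Filter Topology
open scoped Matrix

namespace MultiobjectiveBFGS

/-- `x` is Pareto optimal for `F`: no point `y` satisfies `F y ⪯ F x` (componentwise) and
`F y ≠ F x`. -/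
def IsParetoOptimal {n m : ℕ} (F : EuclideanSpace ℝ (Fin n) → EuclideanSpace ℝ (Fin m))
    (x : EuclideanSpace ℝ (Fin n)) : Prop :=
  ¬ ∃ y, (∀ j, F y j ≤ F x j) ∧ F y ≠ F x

/-- `x` is Pareto critical for `F`: the image of the Jacobian of `F` at `x` does not meet the
open negative orthant. -/
def IsParetoCritical {n m : ℕ} (F : EuclideanSpace ℝ (Fin n) → EuclideanSpace ℝ (Fin m))
    (x : EuclideanSpace ℝ (Fin n)) : Prop :=
  {u : EuclideanSpace ℝ (Fin m) | ∀ j, u j < 0} ∩ Set.range (fderiv ℝ F x) = ∅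

/-- The level set `{y | F y ⪯ F x₀}`. -/
def levelSet {n m : ℕ} (F : EuclideanSpace ℝ (Fin n) → EuclideanSpace ℝ (Fin m))
    (x₀ : EuclideanSpace ℝ (Fin n)) : Set (EuclideanSpace ℝ (Fin n)) :=
  {y | ∀ j, F y j ≤ F x₀ j}

/-- The gradient `∇F_j(x)` of the `j`-th component of `F`. -/
noncomputable def grad {n m : ℕ} (F : EuclideanSpace ℝ (Fin n) → EuclideanSpace ℝ (Fin m))
    (j : Fin m) (x : EuclideanSpace ℝ (Fin n)) : EuclideanSpace ℝ (Fin n) :=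
  gradient (fun z => F z j) x

/-- `D(x, d) = max_j ∇F_j(x)ᵀ d` (a maximum over a finite set, nonempty when `0 < m`). -/
noncomputable def maxSlope {n m : ℕ}
    (F : EuclideanSpace ℝ (Fin n) → EuclideanSpace ℝ (Fin m))
    (x d : EuclideanSpace ℝ (Fin n)) : ℝ :=
  ⨆ j : Fin m, inner ℝ (grad F j x) d

/-- The objective `max_j (∇F_j(x)ᵀ d + (1/2) dᵀ B_j d)` of the search direction subproblem. -/
noncomputable def directionObjective {n m : ℕ}
    (F : EuclideanSpace ℝ (Fin n) → EuclideanSpace ℝ (Fin m))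
    (B : Fin m → Matrix (Fin n) (Fin n) ℝ) (x d : EuclideanSpace ℝ (Fin n)) : ℝ :=
  ⨆ j : Fin m, (inner ℝ (grad F j x) d + (1 / 2) * (d.ofLp ⬝ᵥ (B j *ᵥ d.ofLp)))

/-- The Wolfe conditions for the step size `a` at `x` along `d`. -/
def Wolfe {n m : ℕ} (F : EuclideanSpace ℝ (Fin n) → EuclideanSpace ℝ (Fin m)) (ρ σ : ℝ)
    (x d : EuclideanSpace ℝ (Fin n)) (a : ℝ) : Prop :=
  (∀ j, F (x + a • d) j ≤ F x j + ρ * a * maxSlope F x d) ∧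
    maxSlope F (x + a • d) d ≥ σ * maxSlope F x d

/-- `η_j = y_jᵀ s / ‖s‖²`, where `s = x' - x` and `y_j = ∇F_j(x') - ∇F_j(x)`. -/
noncomputable def eta {n m : ℕ} (F : EuclideanSpace ℝ (Fin n) → EuclideanSpace ℝ (Fin m))
    (x x' : EuclideanSpace ℝ (Fin n)) (j : Fin m) : ℝ :=
  inner ℝ (grad F j x' - grad F j x) (x' - x) / ‖x' - x‖ ^ 2

/-- `r_j = max{-η_j, 0} + ϑ ‖∑ i, μ_i ∇F_i(x)‖`. -/
noncomputable def corr {n m : ℕ} (F : EuclideanSpace ℝ (Fin n) → EuclideanSpace ℝ (Fin m))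
    (μ : Fin m → ℝ) (ϑ : ℝ) (x x' : EuclideanSpace ℝ (Fin n)) (j : Fin m) : ℝ :=
  max (-eta F x x' j) 0 + ϑ * ‖∑ i, μ i • grad F i x‖

/-- `γ_j = y_j + r_j s`. -/
noncomputable def gam {n m : ℕ} (F : EuclideanSpace ℝ (Fin n) → EuclideanSpace ℝ (Fin m))
    (μ : Fin m → ℝ) (ϑ : ℝ) (x x' : EuclideanSpace ℝ (Fin n)) (j : Fin m) :
    EuclideanSpace ℝ (Fin n) :=
  (grad F j x' - grad F j x) + corr F μ ϑ x x' j • (x' - x)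

/-- The BFGS formula `B - (B s sᵀ B) / (sᵀ B s) + (g gᵀ) / (gᵀ s)`. -/
noncomputable def bfgsUpdate {n : ℕ} (B : Matrix (Fin n) (Fin n) ℝ)
    (s g : EuclideanSpace ℝ (Fin n)) : Matrix (Fin n) (Fin n) ℝ :=
  B - (s.ofLp ⬝ᵥ (B *ᵥ s.ofLp))⁻¹ • Matrix.vecMulVec (B *ᵥ s.ofLp) (s.ofLp ᵥ* B)
    + (g.ofLp ⬝ᵥ s.ofLp)⁻¹ • Matrix.vecMulVec g.ofLp g.ofLp

/-- The sequences `x`, `d`, `α`, `B`, `μ`, `ϑ` form an infinite run of the BFGS-type algorithm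
with parameters `ρ`, `σ`, `ϑlo`, `ϑhi`, starting from `x 0` and `B 0`. -/
structure IsRun {n m : ℕ} (F : EuclideanSpace ℝ (Fin n) → EuclideanSpace ℝ (Fin m))
    (ρ σ ϑlo ϑhi : ℝ) (x d : ℕ → EuclideanSpace ℝ (Fin n)) (α : ℕ → ℝ)
    (B : ℕ → Fin m → Matrix (Fin n) (Fin n) ℝ) (μ : ℕ → Fin m → ℝ) (ϑ : ℕ → ℝ) : Prop where
  /-- the initial matrices are (symmetric) positive definite -/
  init : ∀ j, (B 0 j).PosDef
  /-- Step 1: `d k` minimizes the subproblem -/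
  direction : ∀ k v, directionObjective F (B k) (x k) (d k) ≤ directionObjective F (B k) (x k) v
  /-- Step 2: the stopping criterion is never met -/
  not_critical : ∀ k, ¬ IsParetoCritical F (x k)
  /-- Step 3: line search -/
  step_pos : ∀ k, 0 < α k
  wolfe : ∀ k, Wolfe F ρ σ (x k) (d k) (α k)
  next : ∀ k, x (k + 1) = x k + α k • d k
  /-- Step 4: choice of the multipliers and of the factor -/
  simplex : ∀ k, μ k ∈ stdSimplex ℝ (Fin m)
  factor : ∀ k, ϑ k ∈ Set.Ioo ϑlo ϑhi
  /-- Step 5: update of the matrices -/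
  update : ∀ k j, B (k + 1) j =
    bfgsUpdate (B k j) (x (k + 1) - x k) (gam F (μ k) (ϑ k) (x k) (x (k + 1)) j)

end MultiobjectiveBFGS

/-! Suppose that no cluster point of the iterates is Pareto critical. By compactness of the level
set and the simplex, the aggregated gradients in the correction terms eventually stay away from zero
(`IsRun.exists_eventually_le_norm`). Then `γ_jᵀ s ≥ c‖s‖²` and `‖γ_j‖² ≤ C γ_jᵀ s` with fixed
constants. Under these bounds the potential `tr B - log det B`, which is nonnegative, grows by at
most a constant minus `angleDefect` at each update. Summing the potentials over `j` shows that, for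
infinitely many `k`, all the defects are bounded simultaneously
(`IsRun.exists_frequently_angleDefect_le`).

At such `k` each `B_j` behaves along `d` like a uniformly well-conditioned matrix: `dᵀ B_j d ≥
e^{-K}‖d‖²` and `‖B_j d‖ ≤ 2K‖d‖`. Optimality of `d` and a common descent direction at a noncritical
cluster point then bound `‖d‖` below, hence also `D(x,d)²/‖d‖²` (`IsRun.exists_le_sq_maxSlope`). The
Wolfe conditions force this quotient to zero (`IsRun.tendsto_sq_maxSlope`), a contradiction.

So some cluster point `z` is critical, and strict convexity makes it Pareto optimal. The values `F
(x k)` decrease to a limit, so every cluster point has the value `F z`; strict convexity leaves only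
`z`, and compactness gives convergence. -/

namespace MultiobjectiveBFGS

/-! ### Trace, determinant and positivity of one BFGS update. -/

section BFGSMatrix

variable {n : ℕ}

lemma sq_dotProduct_le (u v : Fin n → ℝ) : (u ⬝ᵥ v) ^ 2 ≤ (u ⬝ᵥ u) * (v ⬝ᵥ v) := by
  have h := Finset.sum_mul_sq_le_sq_mul_sq Finset.univ u v
  simpa only [dotProduct, sq] using h

lemma dotProduct_self_pos {u : Fin n → ℝ} (hu : u ≠ 0) : 0 < u ⬝ᵥ u := by
  have h : 0 ≤ u ⬝ᵥ u := Finset.sum_nonneg fun i _ => mul_self_nonneg (u i)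
  exact lt_of_le_of_ne h fun h0 => hu (dotProduct_self_eq_zero.1 h0.symm)

lemma dotProduct_mulVec_pos {B : Matrix (Fin n) (Fin n) ℝ} (hB : B.PosDef) {u : Fin n → ℝ}
    (hu : u ≠ 0) : 0 < u ⬝ᵥ (B *ᵥ u) := by
  simpa using hB.dotProduct_mulVec_pos hu

lemma vecMul_eq_mulVec {B : Matrix (Fin n) (Fin n) ℝ} (hB : B.PosDef) (u : Fin n → ℝ) :
    u ᵥ* B = B *ᵥ u := by
  have h : Bᵀ = B := by simpa using hB.isHermitian.eq
  rw [← Matrix.mulVec_transpose, h]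

lemma dotProduct_mulVec_symm {B : Matrix (Fin n) (Fin n) ℝ} (hB : B.PosDef) (u v : Fin n → ℝ) :
    u ⬝ᵥ (B *ᵥ v) = v ⬝ᵥ (B *ᵥ u) := by
  rw [Matrix.dotProduct_mulVec, vecMul_eq_mulVec hB, dotProduct_comm]

lemma trace_bfgsUpdate {B : Matrix (Fin n) (Fin n) ℝ} (hB : B.PosDef)
    (s g : EuclideanSpace ℝ (Fin n)) :
    (bfgsUpdate B s g).trace = B.trace
      - (s.ofLp ⬝ᵥ (B *ᵥ s.ofLp))⁻¹ * ((B *ᵥ s.ofLp) ⬝ᵥ (B *ᵥ s.ofLp))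
      + (g.ofLp ⬝ᵥ s.ofLp)⁻¹ * (g.ofLp ⬝ᵥ g.ofLp) := by
  simp [bfgsUpdate, vecMul_eq_mulVec hB, Matrix.trace_vecMulVec]

lemma dotProduct_bfgsUpdate_mulVec {B : Matrix (Fin n) (Fin n) ℝ} (hB : B.PosDef)
    (s g : EuclideanSpace ℝ (Fin n)) (v : Fin n → ℝ) :
    v ⬝ᵥ (bfgsUpdate B s g *ᵥ v) = v ⬝ᵥ (B *ᵥ v)
      - (s.ofLp ⬝ᵥ (B *ᵥ s.ofLp))⁻¹ * (v ⬝ᵥ (B *ᵥ s.ofLp)) ^ 2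
      + (g.ofLp ⬝ᵥ s.ofLp)⁻¹ * (g.ofLp ⬝ᵥ v) ^ 2 := by
  simp only [bfgsUpdate, vecMul_eq_mulVec hB, Matrix.add_mulVec, Matrix.sub_mulVec,
    Matrix.smul_mulVec, Matrix.vecMulVec_mulVec, dotProduct_add, dotProduct_sub, dotProduct_smul,
    smul_eq_mul, op_smul_eq_smul]
  rw [dotProduct_comm (B *ᵥ s.ofLp) v, dotProduct_comm v g.ofLp]
  ring

lemma isHermitian_bfgsUpdate {B : Matrix (Fin n) (Fin n) ℝ} (hB : B.PosDef)
    (s g : EuclideanSpace ℝ (Fin n)) : (bfgsUpdate B s g).IsHermitian := by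
  have h (i j) : B i j = B j i := by simpa using (hB.isHermitian.apply i j).symm
  ext i j
  simp only [bfgsUpdate, vecMul_eq_mulVec hB, Matrix.conjTranspose_apply, Matrix.add_apply,
    Matrix.sub_apply, Matrix.smul_apply, Matrix.vecMulVec_apply, smul_eq_mul, star_trivial, h j i]
  ring

/-- The first two terms of the quadratic form at `v` are the `B`-form of the component of `v` that
is `B`-orthogonal to `s`. If that component vanishes, `v` is a nonzero multiple of `s` and the last
rank-one term is positive. -/
lemma posDef_bfgsUpdate {B : Matrix (Fin n) (Fin n) ℝ} (hB : B.PosDef)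
    {s g : EuclideanSpace ℝ (Fin n)} (hg : 0 < g.ofLp ⬝ᵥ s.ofLp) :
    (bfgsUpdate B s g).PosDef := by
  refine Matrix.PosDef.of_dotProduct_mulVec_pos (isHermitian_bfgsUpdate hB s g) fun v hv => ?_
  rw [star_trivial, dotProduct_bfgsUpdate_mulVec hB]
  have hs : s.ofLp ≠ 0 := by
    rintro h
    simp [h] at hg
  have hq := dotProduct_mulVec_pos hB hs
  set q := s.ofLp ⬝ᵥ (B *ᵥ s.ofLp) with hqdef
  set t := q⁻¹ * (v ⬝ᵥ (B *ᵥ s.ofLp)) with ht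
  have key : (v - t • s.ofLp) ⬝ᵥ (B *ᵥ (v - t • s.ofLp)) =
      v ⬝ᵥ (B *ᵥ v) - q⁻¹ * (v ⬝ᵥ (B *ᵥ s.ofLp)) ^ 2 := by
    simp only [Matrix.mulVec_sub, Matrix.mulVec_smul, sub_dotProduct, dotProduct_sub,
      dotProduct_smul, smul_dotProduct, smul_eq_mul]
    rw [dotProduct_mulVec_symm hB s.ofLp v, ← hqdef, ht]
    field_simp
    ring
  rw [← key]
  by_cases hw : v - t • s.ofLp = 0
  · have hv' : v = t • s.ofLp := sub_eq_zero.1 hw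
    have ht0 : t ≠ 0 := by
      rintro h
      exact hv (by rw [hv', h, zero_smul])
    have : 0 < (g.ofLp ⬝ᵥ s.ofLp)⁻¹ * (g.ofLp ⬝ᵥ v) ^ 2 := by
      rw [hv', dotProduct_smul, smul_eq_mul]
      positivity
    rw [hw]
    simpa using this
  · have h1 := dotProduct_mulVec_pos hB hw
    have h2 : 0 ≤ (g.ofLp ⬝ᵥ s.ofLp)⁻¹ * (g.ofLp ⬝ᵥ v) ^ 2 := by positivity
    linarith

/-- The update is `B (1 + U V)` with `U V` of rank at most two, so `det (1 + U V) = det (1 + V U)`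
reduces to a 2 × 2 determinant. Its upper left entry is zero, so the term containing `B⁻¹` drops
out. -/
lemma det_bfgsUpdate {B : Matrix (Fin n) (Fin n) ℝ} (hB : B.PosDef)
    {s g : EuclideanSpace ℝ (Fin n)} (hs : s.ofLp ≠ 0) (hg : g.ofLp ⬝ᵥ s.ofLp ≠ 0) :
    (bfgsUpdate B s g).det = B.det * ((g.ofLp ⬝ᵥ s.ofLp) / (s.ofLp ⬝ᵥ (B *ᵥ s.ofLp))) := by
  have hq := (dotProduct_mulVec_pos hB hs).ne'
  set q := s.ofLp ⬝ᵥ (B *ᵥ s.ofLp) with hqdef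
  have hunit : IsUnit B.det := hB.det_pos.ne'.isUnit
  let U : Matrix (Fin n) (Fin 2) ℝ := (Matrix.of ![s.ofLp, B⁻¹ *ᵥ g.ofLp])ᵀ
  let V : Matrix (Fin 2) (Fin n) ℝ :=
    Matrix.of ![-q⁻¹ • (B *ᵥ s.ofLp), (g.ofLp ⬝ᵥ s.ofLp)⁻¹ • g.ofLp]
  have hBU : B * U = (Matrix.of ![B *ᵥ s.ofLp, g.ofLp])ᵀ := by
    have hBg : B *ᵥ (B⁻¹ *ᵥ g.ofLp) = g.ofLp := by
      rw [Matrix.mulVec_mulVec, Matrix.mul_nonsing_inv _ hunit, Matrix.one_mulVec]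
    ext i k
    fin_cases k
    · simp [U, Matrix.mul_apply, Matrix.mulVec, dotProduct]
    · have := congrFun hBg i
      simpa [U, Matrix.mul_apply, Matrix.mulVec, dotProduct] using this
  have hfac : bfgsUpdate B s g = B * (1 + U * V) := by
    rw [Matrix.mul_add, Matrix.mul_one, ← Matrix.mul_assoc, hBU]
    ext i j
    simp only [bfgsUpdate, vecMul_eq_mulVec hB, Matrix.add_apply, Matrix.sub_apply,
      Matrix.smul_apply, Matrix.vecMulVec_apply, smul_eq_mul, Matrix.mul_apply,
      Fin.sum_univ_two, V]
    simp
    ring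
  have hVU : (1 + V * U) = !![0, -q⁻¹ * (g.ofLp ⬝ᵥ s.ofLp);
      1, 1 + (g.ofLp ⬝ᵥ s.ofLp)⁻¹ * (g.ofLp ⬝ᵥ (B⁻¹ *ᵥ g.ofLp))] := by
    have h00 : (V * U) 0 0 = -1 := by
      change (-q⁻¹ • (B *ᵥ s.ofLp)) ⬝ᵥ s.ofLp = -1
      rw [smul_dotProduct, dotProduct_comm, ← hqdef, smul_eq_mul]
      field_simp
    have h01 : (V * U) 0 1 = -q⁻¹ * (g.ofLp ⬝ᵥ s.ofLp) := by
      change (-q⁻¹ • (B *ᵥ s.ofLp)) ⬝ᵥ (B⁻¹ *ᵥ g.ofLp) = _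
      rw [smul_dotProduct, ← vecMul_eq_mulVec hB, ← Matrix.dotProduct_mulVec,
        Matrix.mulVec_mulVec, Matrix.mul_nonsing_inv _ hunit, Matrix.one_mulVec, smul_eq_mul,
        dotProduct_comm]
    have h10 : (V * U) 1 0 = 1 := by
      change ((g.ofLp ⬝ᵥ s.ofLp)⁻¹ • g.ofLp) ⬝ᵥ s.ofLp = 1
      rw [smul_dotProduct, smul_eq_mul]
      field_simp
    have h11 : (V * U) 1 1 = (g.ofLp ⬝ᵥ s.ofLp)⁻¹ * (g.ofLp ⬝ᵥ (B⁻¹ *ᵥ g.ofLp)) := by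
      change ((g.ofLp ⬝ᵥ s.ofLp)⁻¹ • g.ofLp) ⬝ᵥ (B⁻¹ *ᵥ g.ofLp) = _
      rw [smul_dotProduct, smul_eq_mul]
    ext k l
    fin_cases k <;> fin_cases l <;> simp [h00, h01, h10, h11]
  rw [hfac, Matrix.det_mul, Matrix.det_one_add_mul_comm, hVU, Matrix.det_fin_two_of]
  field_simp
  ring

/-! ### The potential `tr B - log det B` and the angle defect. -/

lemma log_det_le_trace {B : Matrix (Fin n) (Fin n) ℝ} (hB : B.PosDef) :
    Real.log B.det ≤ B.trace := by
  have hd := hB.isHermitian.det_eq_prod_eigenvalues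
  have ht := hB.isHermitian.trace_eq_sum_eigenvalues
  simp only [RCLike.ofReal_real_eq_id, id_eq] at hd ht
  rw [hd, ht, Real.log_prod fun i _ => (hB.eigenvalues_pos i).ne']
  refine Finset.sum_le_sum fun i _ => ?_
  linarith [Real.log_le_sub_one_of_pos (hB.eigenvalues_pos i)]

/-- The quantity `‖B s‖² / (sᵀ B s) - log (sᵀ B s / ‖s‖²)`, which controls both the angle between
`s` and `B s` and the ratio of their lengths. -/
noncomputable def angleDefect (B : Matrix (Fin n) (Fin n) ℝ) (s : Fin n → ℝ) : ℝ :=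
  ((B *ᵥ s) ⬝ᵥ (B *ᵥ s)) / (s ⬝ᵥ (B *ᵥ s)) - Real.log ((s ⬝ᵥ (B *ᵥ s)) / (s ⬝ᵥ s))

lemma trace_sub_log_det_bfgsUpdate_le {B : Matrix (Fin n) (Fin n) ℝ} (hB : B.PosDef)
    {s g : EuclideanSpace ℝ (Fin n)} (hs : s.ofLp ≠ 0) {c C : ℝ} (hc : 0 < c)
    (hcg : c * (s.ofLp ⬝ᵥ s.ofLp) ≤ g.ofLp ⬝ᵥ s.ofLp)
    (hCg : g.ofLp ⬝ᵥ g.ofLp ≤ C * (g.ofLp ⬝ᵥ s.ofLp)) :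
    (bfgsUpdate B s g).trace - Real.log (bfgsUpdate B s g).det ≤
      (B.trace - Real.log B.det) + (C - Real.log c) - angleDefect B s.ofLp := by
  have hss := dotProduct_self_pos hs
  have hq := dotProduct_mulVec_pos hB hs
  have hg : 0 < g.ofLp ⬝ᵥ s.ofLp := lt_of_lt_of_le (by positivity) hcg
  rw [trace_bfgsUpdate hB, det_bfgsUpdate hB hs hg.ne', angleDefect,
    Real.log_mul hB.det_pos.ne' (by positivity), Real.log_div hg.ne' hq.ne',
    Real.log_div hq.ne' hss.ne']
  have h1 : (g.ofLp ⬝ᵥ s.ofLp)⁻¹ * (g.ofLp ⬝ᵥ g.ofLp) ≤ C := by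
    rw [inv_mul_le_iff₀ hg]
    linarith
  have h2 : Real.log c + Real.log (s.ofLp ⬝ᵥ s.ofLp) ≤ Real.log (g.ofLp ⬝ᵥ s.ofLp) := by
    rw [← Real.log_mul hc.ne' hss.ne']
    exact Real.log_le_log (by positivity) hcg
  rw [div_eq_inv_mul]
  linarith

lemma div_le_div_of_posDef {B : Matrix (Fin n) (Fin n) ℝ} (hB : B.PosDef) {s : Fin n → ℝ}
    (hs : s ≠ 0) :
    (s ⬝ᵥ (B *ᵥ s)) / (s ⬝ᵥ s) ≤ ((B *ᵥ s) ⬝ᵥ (B *ᵥ s)) / (s ⬝ᵥ (B *ᵥ s)) := by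
  rw [div_le_div_iff₀ (dotProduct_self_pos hs) (dotProduct_mulVec_pos hB hs)]
  linarith [sq_dotProduct_le s (B *ᵥ s)]

/-- Cauchy-Schwarz bounds the first term below by `q = sᵀ B s / ‖s‖²`, and `q - log q ≥ 1`. -/
lemma angleDefect_nonneg {B : Matrix (Fin n) (Fin n) ℝ} (hB : B.PosDef) {s : Fin n → ℝ}
    (hs : s ≠ 0) : 0 ≤ angleDefect B s := by
  have h := div_le_div_of_posDef hB hs
  have h2 := Real.log_le_sub_one_of_pos
    (div_pos (dotProduct_mulVec_pos hB hs) (dotProduct_self_pos hs))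
  rw [angleDefect]
  linarith

lemma le_dotProduct_mulVec_of_angleDefect_le {B : Matrix (Fin n) (Fin n) ℝ} (hB : B.PosDef)
    {s : Fin n → ℝ} (hs : s ≠ 0) {K : ℝ} (hK : angleDefect B s ≤ K) :
    Real.exp (-K) * (s ⬝ᵥ s) ≤ s ⬝ᵥ (B *ᵥ s) := by
  have hss := dotProduct_self_pos hs
  have hq := dotProduct_mulVec_pos hB hs
  have hu : 0 ≤ ((B *ᵥ s) ⬝ᵥ (B *ᵥ s)) / (s ⬝ᵥ (B *ᵥ s)) :=
    le_trans (by positivity) (div_le_div_of_posDef hB hs)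
  rw [angleDefect] at hK
  rw [← le_div_iff₀ hss, ← Real.le_log_iff_exp_le (by positivity)]
  linarith

lemma mulVec_dotProduct_le_of_angleDefect_le {B : Matrix (Fin n) (Fin n) ℝ} (hB : B.PosDef)
    {s : Fin n → ℝ} (hs : s ≠ 0) {K : ℝ} (hK : angleDefect B s ≤ K) :
    (B *ᵥ s) ⬝ᵥ (B *ᵥ s) ≤ (2 * K) ^ 2 * (s ⬝ᵥ s) := by
  have hss := dotProduct_self_pos hs
  have hq := dotProduct_mulVec_pos hB hs
  have hqu := div_le_div_of_posDef hB hs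
  have hq' : 0 < (s ⬝ᵥ (B *ᵥ s)) / (s ⬝ᵥ s) := by positivity
  have hu' := hq'.trans_le hqu
  rw [angleDefect] at hK
  set u := ((B *ᵥ s) ⬝ᵥ (B *ᵥ s)) / (s ⬝ᵥ (B *ᵥ s)) with hu
  have h1 : Real.log (s ⬝ᵥ (B *ᵥ s) / s ⬝ᵥ s) ≤ Real.log u := Real.log_le_log hq' hqu
  -- Half of `u` absorbs the logarithm, leaving `u / 2 ≤ K`; this is the origin of the factor `2 *
  -- K`.
  have h2 : Real.log u ≤ u / 2 := by
    have h3 := Real.log_le_sub_one_of_pos (half_pos hu')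
    rw [Real.log_div hu'.ne' two_ne_zero] at h3
    have h4 : Real.log 2 ≤ 1 := by
      have := Real.log_le_sub_one_of_pos (zero_lt_two (α := ℝ))
      linarith
    linarith
  have hu2 : u ≤ 2 * K := by linarith
  have e1 : (B *ᵥ s) ⬝ᵥ (B *ᵥ s) = u * (s ⬝ᵥ (B *ᵥ s)) := by
    rw [hu]
    field_simp
  have e2 : s ⬝ᵥ (B *ᵥ s) ≤ u * (s ⬝ᵥ s) := (div_le_iff₀ hss).1 hqu
  calc (B *ᵥ s) ⬝ᵥ (B *ᵥ s) = u * (s ⬝ᵥ (B *ᵥ s)) := e1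
    _ ≤ u * (u * (s ⬝ᵥ s)) := by gcongr
    _ = u ^ 2 * (s ⬝ᵥ s) := by ring
    _ ≤ (2 * K) ^ 2 * (s ⬝ᵥ s) := by gcongr

end BFGSMatrix

/-! ### Gradients and Pareto criticality. -/

section Descent

variable {n m : ℕ} {F : EuclideanSpace ℝ (Fin n) → EuclideanSpace ℝ (Fin m)}

lemma inner_eq_dotProduct (u v : EuclideanSpace ℝ (Fin n)) :
    inner ℝ u v = u.ofLp ⬝ᵥ v.ofLp := by
  rw [EuclideanSpace.inner_eq_star_dotProduct, star_trivial, dotProduct_comm]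

lemma dotProduct_self_eq_norm_sq (u : EuclideanSpace ℝ (Fin n)) :
    u.ofLp ⬝ᵥ u.ofLp = ‖u‖ ^ 2 := by
  rw [← inner_eq_dotProduct, real_inner_self_eq_norm_sq]

lemma contDiff_component (hF : ContDiff ℝ 1 F) (j : Fin m) : ContDiff ℝ 1 fun z => F z j :=
  (contDiff_euclidean.1 hF) j

lemma inner_grad (j : Fin m) (x v : EuclideanSpace ℝ (Fin n)) :
    inner ℝ (grad F j x) v = fderiv ℝ (fun z => F z j) x v := by
  rw [grad, gradient, InnerProductSpace.toDual_symm_apply]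

lemma fderiv_apply_component (hF : ContDiff ℝ 1 F) (j : Fin m)
    (x v : EuclideanSpace ℝ (Fin n)) :
    fderiv ℝ F x v j = inner ℝ (grad F j x) v := by
  rw [inner_grad]
  have h := hF.contDiffAt.hasStrictFDerivAt (x := x) one_ne_zero
  have hj := (hasStrictFDerivAt_euclidean.1 h j).hasFDerivAt
  rw [hj.fderiv]
  rfl

lemma continuous_grad (hF : ContDiff ℝ 1 F) (j : Fin m) : Continuous (grad F j) := by
  have h := (contDiff_component hF j).continuous_fderiv one_ne_zero
  exact (InnerProductSpace.toDual ℝ (EuclideanSpace ℝ (Fin n))).symm.continuous.comp h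

lemma not_isParetoCritical_iff (hF : ContDiff ℝ 1 F) {x : EuclideanSpace ℝ (Fin n)} :
    ¬ IsParetoCritical F x ↔ ∃ v, ∀ j, inner ℝ (grad F j x) v < 0 := by
  rw [IsParetoCritical, ← ne_eq, ← Set.nonempty_iff_ne_empty]
  constructor
  · rintro ⟨_, hu, v, rfl⟩
    exact ⟨v, fun j => by rw [← fderiv_apply_component hF]; exact hu j⟩
  · rintro ⟨v, hv⟩
    exact ⟨_, fun j => by rw [fderiv_apply_component hF]; exact hv j, v, rfl⟩

lemma sum_smul_grad_ne_zero (hF : ContDiff ℝ 1 F) {x : EuclideanSpace ℝ (Fin n)}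
    (hx : ¬ IsParetoCritical F x) {μ : Fin m → ℝ} (hμ : μ ∈ stdSimplex ℝ (Fin m)) :
    ∑ i, μ i • grad F i x ≠ 0 := by
  obtain ⟨v, hv⟩ := (not_isParetoCritical_iff hF).1 hx
  intro h0
  have h1 : ∑ i, μ i * inner ℝ (grad F i x) v = 0 := by
    have := congrArg (fun w => inner ℝ w v) h0
    simpa [sum_inner, real_inner_smul_left] using this
  have hle : ∀ i ∈ Finset.univ, μ i * inner ℝ (grad F i x) v ≤ 0 := fun i _ =>
    mul_nonpos_of_nonneg_of_nonpos (hμ.1 i) (hv i).le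
  have h2 := (Finset.sum_eq_zero_iff_of_nonpos hle).1 h1
  have h3 : ∀ i, μ i = 0 := fun i => by
    have := h2 i (Finset.mem_univ i)
    exact (mul_eq_zero.1 this).resolve_right (hv i).ne
  have h4 := hμ.2
  simp [h3] at h4

/-! ### The direction subproblem. -/

lemma le_maxSlope (x d : EuclideanSpace ℝ (Fin n)) (j : Fin m) :
    inner ℝ (grad F j x) d ≤ maxSlope F x d :=
  le_ciSup (f := fun j => inner ℝ (grad F j x) d) (Set.finite_range _).bddAbove j

lemma exists_eq_maxSlope (hm : 0 < m) (x d : EuclideanSpace ℝ (Fin n)) :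
    ∃ j, inner ℝ (grad F j x) d = maxSlope F x d := by
  have : Nonempty (Fin m) := ⟨⟨0, hm⟩⟩
  exact exists_eq_ciSup_of_finite (f := fun j => inner ℝ (grad F j x) d)

lemma le_directionObjective (B : Fin m → Matrix (Fin n) (Fin n) ℝ)
    (x d : EuclideanSpace ℝ (Fin n)) (j : Fin m) :
    inner ℝ (grad F j x) d + (1 / 2) * (d.ofLp ⬝ᵥ (B j *ᵥ d.ofLp)) ≤
      directionObjective F B x d :=
  le_ciSup (f := fun j => inner ℝ (grad F j x) d + (1 / 2) * (d.ofLp ⬝ᵥ (B j *ᵥ d.ofLp)))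
    (Set.finite_range _).bddAbove j

lemma exists_eq_directionObjective (hm : 0 < m) (B : Fin m → Matrix (Fin n) (Fin n) ℝ)
    (x d : EuclideanSpace ℝ (Fin n)) :
    ∃ j, inner ℝ (grad F j x) d + (1 / 2) * (d.ofLp ⬝ᵥ (B j *ᵥ d.ofLp)) =
      directionObjective F B x d := by
  have : Nonempty (Fin m) := ⟨⟨0, hm⟩⟩
  exact exists_eq_ciSup_of_finite
    (f := fun j => inner ℝ (grad F j x) d + (1 / 2) * (d.ofLp ⬝ᵥ (B j *ᵥ d.ofLp)))

/-- Moving from `d` to `d + t h` changes each component by `t` times an expression that tends to the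
assumed negative number. For small `t > 0` all components drop strictly, hence so does their
maximum, without identifying the active indices. -/
lemma exists_directionObjective_lt (hm : 0 < m) {B : Fin m → Matrix (Fin n) (Fin n) ℝ}
    (hB : ∀ j, (B j).PosDef) {x d h : EuclideanSpace ℝ (Fin n)}
    (hh : ∀ j, inner ℝ (grad F j x) h + h.ofLp ⬝ᵥ (B j *ᵥ d.ofLp) < 0) :
    ∃ w, directionObjective F B x w < directionObjective F B x d := by
  have hev : ∀ᶠ t in 𝓝[>] (0 : ℝ), ∀ j, inner ℝ (grad F j x) h + h.ofLp ⬝ᵥ (B j *ᵥ d.ofLp)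
      + t / 2 * (h.ofLp ⬝ᵥ (B j *ᵥ h.ofLp)) < 0 := by
    refine eventually_all.2 fun j => nhdsWithin_le_nhds ?_
    have hc : Continuous fun t : ℝ => inner ℝ (grad F j x) h + h.ofLp ⬝ᵥ (B j *ᵥ d.ofLp)
      + t / 2 * (h.ofLp ⬝ᵥ (B j *ᵥ h.ofLp)) := by fun_prop
    refine hc.continuousAt.eventually_lt continuousAt_const ?_
    simpa using hh j
  obtain ⟨t, ht, htpos⟩ := (hev.and self_mem_nhdsWithin).exists
  refine ⟨d + t • h, ?_⟩
  obtain ⟨j, hj⟩ := exists_eq_directionObjective (F := F) hm B x (d + t • h)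
  rw [← hj]
  refine lt_of_lt_of_le ?_ (le_directionObjective B x d j)
  have h1 := mul_neg_of_pos_of_neg (Set.mem_Ioi.1 htpos) (ht j)
  simp only [WithLp.ofLp_add, WithLp.ofLp_smul, inner_add_right, real_inner_smul_right,
    Matrix.mulVec_add, Matrix.mulVec_smul, add_dotProduct, dotProduct_add, smul_dotProduct,
    dotProduct_smul, smul_eq_mul]
  rw [dotProduct_mulVec_symm (hB j) d.ofLp h.ofLp]
  linarith

lemma directionObjective_zero (hm : 0 < m) (B : Fin m → Matrix (Fin n) (Fin n) ℝ)
    (x : EuclideanSpace ℝ (Fin n)) : directionObjective F B x 0 = 0 := by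
  obtain ⟨j, hj⟩ := exists_eq_directionObjective (F := F) hm B x 0
  rw [← hj]
  simp

lemma directionObjective_neg (hF : ContDiff ℝ 1 F) (hm : 0 < m)
    {B : Fin m → Matrix (Fin n) (Fin n) ℝ} (hB : ∀ j, (B j).PosDef)
    {x d : EuclideanSpace ℝ (Fin n)} (hx : ¬ IsParetoCritical F x)
    (hd : ∀ v, directionObjective F B x d ≤ directionObjective F B x v) :
    directionObjective F B x d < 0 := by
  obtain ⟨v, hv⟩ := (not_isParetoCritical_iff hF).1 hx
  obtain ⟨w, hw⟩ := exists_directionObjective_lt (F := F) hm hB (x := x) (d := 0) (h := v)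
    (fun j => by simpa using hv j)
  rw [directionObjective_zero hm] at hw
  exact (hd w).trans_lt hw

lemma maxSlope_le (hF : ContDiff ℝ 1 F) (hm : 0 < m)
    {B : Fin m → Matrix (Fin n) (Fin n) ℝ} (hB : ∀ j, (B j).PosDef)
    {x d : EuclideanSpace ℝ (Fin n)} (hx : ¬ IsParetoCritical F x)
    (hd : ∀ v, directionObjective F B x d ≤ directionObjective F B x v) {c : ℝ}
    (hc : ∀ j, c ≤ d.ofLp ⬝ᵥ (B j *ᵥ d.ofLp)) : maxSlope F x d ≤ -(c / 2) := by
  obtain ⟨j, hj⟩ := exists_eq_maxSlope (F := F) hm x d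
  have h1 := le_directionObjective (F := F) B x d j
  have h2 := directionObjective_neg hF hm hB hx hd
  linarith [hc j]

lemma direction_ne_zero (hF : ContDiff ℝ 1 F) (hm : 0 < m)
    {B : Fin m → Matrix (Fin n) (Fin n) ℝ} (hB : ∀ j, (B j).PosDef)
    {x d : EuclideanSpace ℝ (Fin n)} (hx : ¬ IsParetoCritical F x)
    (hd : ∀ v, directionObjective F B x d ≤ directionObjective F B x v) : d ≠ 0 := by
  rintro rfl
  have := directionObjective_neg hF hm hB hx hd
  rw [directionObjective_zero hm] at this
  exact lt_irrefl _ this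

lemma maxSlope_neg (hF : ContDiff ℝ 1 F) (hm : 0 < m)
    {B : Fin m → Matrix (Fin n) (Fin n) ℝ} (hB : ∀ j, (B j).PosDef)
    {x d : EuclideanSpace ℝ (Fin n)} (hx : ¬ IsParetoCritical F x)
    (hd : ∀ v, directionObjective F B x d ≤ directionObjective F B x v) :
    maxSlope F x d < 0 := by
  have hd0 : d.ofLp ≠ 0 := by
    simpa using direction_ne_zero hF hm hB hx hd
  obtain ⟨j, hj⟩ := exists_eq_maxSlope (F := F) hm x d
  have h1 := le_directionObjective (F := F) B x d j
  have h2 := directionObjective_neg hF hm hB hx hd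
  linarith [dotProduct_mulVec_pos (hB j) hd0]

/-- A first-order optimality condition in primal form; it takes the place of KKT multipliers. -/
lemma exists_nonneg_of_minimizer (hm : 0 < m)
    {B : Fin m → Matrix (Fin n) (Fin n) ℝ} (hB : ∀ j, (B j).PosDef)
    {x d : EuclideanSpace ℝ (Fin n)}
    (hd : ∀ v, directionObjective F B x d ≤ directionObjective F B x v)
    (h : EuclideanSpace ℝ (Fin n)) :
    ∃ j, 0 ≤ inner ℝ (grad F j x) h + h.ofLp ⬝ᵥ (B j *ᵥ d.ofLp) := by
  by_contra! hcon
  obtain ⟨w, hw⟩ := exists_directionObjective_lt hm hB hcon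
  exact (hd w).not_gt hw

/-! ### Curvature of the corrected differences, and the Wolfe decrease. -/

lemma le_inner_gam {x x' : EuclideanSpace ℝ (Fin n)} (hx : x' - x ≠ 0) (μ : Fin m → ℝ) (θ : ℝ)
    (j : Fin m) :
    θ * ‖∑ i, μ i • grad F i x‖ * ‖x' - x‖ ^ 2 ≤
      inner ℝ (gam F μ θ x x' j) (x' - x) := by
  have hs : 0 < ‖x' - x‖ ^ 2 := by positivity
  rw [gam, inner_add_left, real_inner_smul_left, real_inner_self_eq_norm_sq, corr]
  have h1 : inner ℝ (grad F j x' - grad F j x) (x' - x) = eta F x x' j * ‖x' - x‖ ^ 2 := by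
    rw [eta]
    field_simp
  rw [h1]
  have h2 : 0 ≤ eta F x x' j + max (-eta F x x' j) 0 := by
    linarith [le_max_left (-eta F x x' j) 0]
  nlinarith [mul_nonneg h2 hs.le]

lemma norm_gam_le {x x' : EuclideanSpace ℝ (Fin n)} (hx : x' - x ≠ 0) (μ : Fin m → ℝ)
    {θ : ℝ} (hθ : 0 ≤ θ) {j : Fin m} {L : ℝ}
    (hL : ‖grad F j x' - grad F j x‖ ≤ L * ‖x' - x‖) :
    ‖gam F μ θ x x' j‖ ≤ (2 * L + θ * ‖∑ i, μ i • grad F i x‖) * ‖x' - x‖ := by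
  have hs : 0 < ‖x' - x‖ := norm_pos_iff.2 hx
  have hL0 : 0 ≤ L := by
    by_contra! h
    linarith [norm_nonneg (grad F j x' - grad F j x), mul_neg_of_neg_of_pos h hs]
  have heta : |eta F x x' j| ≤ L := by
    rw [eta, abs_div, abs_of_pos (pow_pos hs 2), div_le_iff₀ (pow_pos hs 2)]
    calc _ ≤ ‖grad F j x' - grad F j x‖ * ‖x' - x‖ := abs_real_inner_le_norm _ _
      _ ≤ L * ‖x' - x‖ * ‖x' - x‖ := by gcongr
      _ = _ := by ring
  have hr0 : 0 ≤ corr F μ θ x x' j := by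
    rw [corr]
    positivity
  have hr : corr F μ θ x x' j ≤ L + θ * ‖∑ i, μ i • grad F i x‖ := by
    rw [corr]
    have : max (-eta F x x' j) 0 ≤ L := max_le ((neg_le_abs _).trans heta) hL0
    linarith
  calc ‖gam F μ θ x x' j‖ ≤ ‖grad F j x' - grad F j x‖ + ‖corr F μ θ x x' j • (x' - x)‖ :=
        norm_add_le _ _
    _ = ‖grad F j x' - grad F j x‖ + corr F μ θ x x' j * ‖x' - x‖ := by
        rw [norm_smul, Real.norm_of_nonneg hr0]
    _ ≤ L * ‖x' - x‖ + (L + θ * ‖∑ i, μ i • grad F i x‖) * ‖x' - x‖ := by gcongr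
    _ = _ := by ring

/-- One term of a Zoutendijk estimate: the curvature condition and the Lipschitz bound keep the step
from being too short, and sufficient decrease turns this into a drop of every component. -/
lemma sq_maxSlope_le (hm : 0 < m) {ρ σ : ℝ} (hρ : 0 < ρ) (hσ : σ < 1)
    {x d : EuclideanSpace ℝ (Fin n)} {a L : ℝ} (ha : 0 < a) (hd : d ≠ 0)
    (hD : maxSlope F x d < 0) (hw : Wolfe F ρ σ x d a)
    (hL : ∀ j, ‖grad F j (x + a • d) - grad F j x‖ ≤ L * ‖a • d‖) (i : Fin m) :
    maxSlope F x d ^ 2 / ‖d‖ ^ 2 ≤ L / (ρ * (1 - σ)) * (F x i - F (x + a • d) i) := by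
  have hd' : 0 < ‖d‖ := norm_pos_iff.2 hd
  obtain ⟨j, hj⟩ := exists_eq_maxSlope (F := F) hm (x + a • d) d
  have h1 : inner ℝ (grad F j (x + a • d) - grad F j x) d ≤ L * a * ‖d‖ ^ 2 := by
    calc _ ≤ ‖grad F j (x + a • d) - grad F j x‖ * ‖d‖ := real_inner_le_norm _ _
      _ ≤ L * ‖a • d‖ * ‖d‖ := by gcongr; exact hL j
      _ = _ := by rw [norm_smul, Real.norm_of_nonneg ha.le]; ring
  rw [inner_sub_left, hj] at h1
  have h2 := hw.2
  have h3 := le_maxSlope (F := F) x d j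
  have h4 : (1 - σ) * (-maxSlope F x d) ≤ L * a * ‖d‖ ^ 2 := by linarith
  have h5 := hw.1 i
  have hσ' : 0 < 1 - σ := by linarith
  have hL0 : 0 ≤ L := by
    by_contra! h
    have : L * a * ‖d‖ ^ 2 < 0 :=
      mul_neg_of_neg_of_pos (mul_neg_of_neg_of_pos h ha) (by positivity)
    linarith [mul_pos hσ' (neg_pos.2 hD)]
  rw [div_mul_eq_mul_div, div_le_div_iff₀ (by positivity) (by positivity)]
  have h6 : L * ‖d‖ ^ 2 * (ρ * a * -maxSlope F x d) ≤
      L * ‖d‖ ^ 2 * (F x i - F (x + a • d) i) := by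
    refine mul_le_mul_of_nonneg_left ?_ (by positivity)
    linarith
  have h7 := mul_le_mul_of_nonneg_left h4 (mul_nonneg hρ.le (neg_pos.2 hD).le)
  linarith

lemma angleDefect_smul (B : Matrix (Fin n) (Fin n) ℝ) (s : Fin n → ℝ) {a : ℝ} (ha : a ≠ 0) :
    angleDefect B (a • s) = angleDefect B s := by
  simp only [angleDefect, Matrix.mulVec_smul, smul_dotProduct, dotProduct_smul, smul_eq_mul]
  rw [mul_div_mul_left _ _ ha, mul_div_mul_left _ _ ha, mul_div_mul_left _ _ ha,
    mul_div_mul_left _ _ ha]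

/-- Otherwise `ψ` would eventually lose at least 1 per step and become negative. -/
lemma frequently_le_of_add_le {f ψ : ℕ → ℝ} {C : ℝ} (hψ : ∀ k, 0 ≤ ψ k)
    (h : ∀ᶠ k in atTop, ψ (k + 1) ≤ ψ k + C - f k) : ∃ᶠ k in atTop, f k ≤ C + 1 := by
  by_contra hcon
  obtain ⟨N, hN⟩ := eventually_atTop.1 (h.and (not_frequently.1 hcon))
  have h1 : ∀ i : ℕ, ψ (N + i) ≤ ψ N - i := by
    intro i
    induction i with
    | zero => simp
    | succ i ih =>
      obtain ⟨h2, h3⟩ := hN (N + i) (Nat.le_add_right _ _)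
      push_cast
      rw [← add_assoc]
      linarith
  obtain ⟨i, hi⟩ := exists_nat_gt (ψ N)
  linarith [h1 i, hψ (N + i)]

/-! ### Consequences of strict convexity. -/

lemma component_midpoint_lt
    (hconv : ∀ j, StrictConvexOn ℝ Set.univ (fun z => F z j))
    {x y : EuclideanSpace ℝ (Fin n)} (hxy : x ≠ y) (hle : ∀ j, F y j ≤ F x j) (j : Fin m) :
    F (midpoint ℝ x y) j < F x j := by
  have h := (hconv j).2 (Set.mem_univ x) (Set.mem_univ y) hxy (one_half_pos (α := ℝ))
    (one_half_pos (α := ℝ)) (add_halves 1)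
  have e : midpoint ℝ x y = (1 / 2 : ℝ) • x + (1 / 2 : ℝ) • y := by
    rw [midpoint_eq_smul_add, smul_add]
    norm_num
  rw [e]
  simp only [smul_eq_mul] at h
  linarith [hle j]

lemma inner_grad_le_sub (hF : ContDiff ℝ 1 F) {j : Fin m}
    (hconv : ConvexOn ℝ Set.univ (fun z => F z j)) (x z : EuclideanSpace ℝ (Fin n)) :
    inner ℝ (grad F j x) (z - x) ≤ F z j - F x j := by
  have hd : HasFDerivAt (fun z => F z j) (fderiv ℝ (fun z => F z j) x) x :=
    ((contDiff_component hF j).differentiable one_ne_zero x).hasFDerivAt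
  have hl := (hd.hasLineDerivAt (z - x)).tendsto_slope_zero_right
  rw [inner_grad]
  refine le_of_tendsto hl ?_
  filter_upwards [Ioo_mem_nhdsGT (zero_lt_one (α := ℝ))] with t ht
  have h := hconv.2 (Set.mem_univ x) (Set.mem_univ z) (sub_nonneg.2 ht.2.le) ht.1.le
    (sub_add_cancel 1 t)
  have e : x + t • (z - x) = (1 - t) • x + t • z := by module
  rw [← e] at h
  simp only [smul_eq_mul] at h ⊢
  rw [inv_mul_le_iff₀ ht.1]
  linarith

/-- If `y` dominated `x`, the midpoint would strictly improve every component, and by the gradient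
inequality the direction towards it would be a common descent direction. -/
lemma isParetoOptimal_of_isParetoCritical (hF : ContDiff ℝ 1 F)
    (hconv : ∀ j, StrictConvexOn ℝ Set.univ (fun z => F z j))
    {x : EuclideanSpace ℝ (Fin n)} (hx : IsParetoCritical F x) : IsParetoOptimal F x := by
  rintro ⟨y, hle, hne⟩
  have hxy : x ≠ y := by
    rintro rfl
    exact hne rfl
  refine (not_isParetoCritical_iff hF).2 ⟨midpoint ℝ x y - x, fun j => ?_⟩ hx
  have h1 := inner_grad_le_sub hF (hconv j).convexOn x (midpoint ℝ x y)
  have h2 := component_midpoint_lt hconv hxy hle j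
  linarith

lemma eq_of_isParetoOptimal (hm : 0 < m)
    (hconv : ∀ j, StrictConvexOn ℝ Set.univ (fun z => F z j))
    {x y : EuclideanSpace ℝ (Fin n)} (hx : IsParetoOptimal F x) (hle : ∀ j, F y j ≤ F x j) :
    y = x := by
  by_contra hne
  have h := component_midpoint_lt hconv (Ne.symm hne) hle
  refine hx ⟨_, fun j => (h j).le, fun he => ?_⟩
  have := h ⟨0, hm⟩
  rw [he] at this
  exact lt_irrefl _ this

end Descent

/-! ### Asymptotics of a run of the algorithm. -/

section Run

variable {n m : ℕ} {F : EuclideanSpace ℝ (Fin n) → EuclideanSpace ℝ (Fin m)}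
  {ρ σ ϑlo ϑhi : ℝ} {x d : ℕ → EuclideanSpace ℝ (Fin n)} {α : ℕ → ℝ}
  {B : ℕ → Fin m → Matrix (Fin n) (Fin n) ℝ} {μ : ℕ → Fin m → ℝ} {ϑ : ℕ → ℝ}

lemma isCompact_levelSet (hF : ContDiff ℝ 1 F) {x₀ : EuclideanSpace ℝ (Fin n)}
    (hbdd : Bornology.IsBounded (levelSet F x₀)) : IsCompact (levelSet F x₀) := by
  refine Metric.isCompact_of_isClosed_isBounded ?_ hbdd
  rw [levelSet, Set.ofPred_forall]
  exact isClosed_iInter fun j => isClosed_le (contDiff_component hF j).continuous continuous_const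

lemma continuous_norm_sum_smul_grad (hF : ContDiff ℝ 1 F) :
    Continuous fun p : EuclideanSpace ℝ (Fin n) × (Fin m → ℝ) => ‖∑ i, p.2 i • grad F i p.1‖ :=
  (continuous_finsetSum _ fun i _ => ((continuous_apply i).comp continuous_snd).smul
    ((continuous_grad hF i).comp continuous_fst)).norm

lemma IsRun.step_ne_zero_of_posDef (hrun : IsRun F ρ σ ϑlo ϑhi x d α B μ ϑ) (hF : ContDiff ℝ 1 F)
    (hm : 0 < m) {k : ℕ} (hB : ∀ j, (B k j).PosDef) : x (k + 1) - x k ≠ 0 := by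
  rw [hrun.next, add_sub_cancel_left]
  exact smul_ne_zero (hrun.step_pos k).ne'
    (direction_ne_zero hF hm hB (hrun.not_critical k) (hrun.direction k))

lemma IsRun.posDef (hrun : IsRun F ρ σ ϑlo ϑhi x d α B μ ϑ) (hF : ContDiff ℝ 1 F)
    (hm : 0 < m) (hϑ : 0 < ϑlo) (k : ℕ) : ∀ j, (B k j).PosDef := by
  induction k with
  | zero => exact hrun.init
  | succ k ih =>
    intro j
    have hs := hrun.step_ne_zero_of_posDef hF hm ih
    rw [hrun.update]
    refine posDef_bfgsUpdate (ih j) ?_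
    rw [← inner_eq_dotProduct]
    refine lt_of_lt_of_le ?_ (le_inner_gam hs (μ k) (ϑ k) j)
    have h1 := norm_pos_iff.2 (sum_smul_grad_ne_zero hF (hrun.not_critical k) (hrun.simplex k))
    have h2 : 0 < ϑ k := hϑ.trans (hrun.factor k).1
    have h3 := norm_pos_iff.2 hs
    positivity

lemma IsRun.direction_ne_zero (hrun : IsRun F ρ σ ϑlo ϑhi x d α B μ ϑ) (hF : ContDiff ℝ 1 F)
    (hm : 0 < m) (hϑ : 0 < ϑlo) (k : ℕ) : d k ≠ 0 :=
  MultiobjectiveBFGS.direction_ne_zero hF hm (hrun.posDef hF hm hϑ k) (hrun.not_critical k)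
    (hrun.direction k)

lemma IsRun.antitone (hrun : IsRun F ρ σ ϑlo ϑhi x d α B μ ϑ) (hF : ContDiff ℝ 1 F)
    (hm : 0 < m) (hϑ : 0 < ϑlo) (hρ : 0 < ρ) (j : Fin m) : Antitone fun k => F (x k) j := by
  refine antitone_nat_of_succ_le fun k => ?_
  have h := (hrun.wolfe k).1 j
  have hD := maxSlope_neg hF hm (hrun.posDef hF hm hϑ k) (hrun.not_critical k)
    (hrun.direction k)
  rw [hrun.next]
  have := mul_neg_of_pos_of_neg (mul_pos hρ (hrun.step_pos k)) hD
  linarith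

lemma IsRun.mem_levelSet (hrun : IsRun F ρ σ ϑlo ϑhi x d α B μ ϑ) (hF : ContDiff ℝ 1 F)
    (hm : 0 < m) (hϑ : 0 < ϑlo) (hρ : 0 < ρ) (k : ℕ) : x k ∈ levelSet F (x 0) :=
  fun j => hrun.antitone hF hm hϑ hρ j (Nat.zero_le k)

lemma IsRun.tendsto_values (hrun : IsRun F ρ σ ϑlo ϑhi x d α B μ ϑ) (hF : ContDiff ℝ 1 F)
    (hm : 0 < m) (hϑ : 0 < ϑlo) (hρ : 0 < ρ)
    (hbdd : Bornology.IsBounded (levelSet F (x 0))) (j : Fin m) :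
    ∃ c, Tendsto (fun k => F (x k) j) atTop (𝓝 c) := by
  have hK := isCompact_levelSet hF hbdd
  have hb := hK.bddBelow_image (contDiff_component hF j).continuous.continuousOn
  refine ⟨_, tendsto_atTop_ciInf (hrun.antitone hF hm hϑ hρ j) (hb.mono ?_)⟩
  rintro _ ⟨k, rfl⟩
  exact ⟨x k, hrun.mem_levelSet hF hm hϑ hρ k, rfl⟩

lemma IsRun.tendsto_sq_maxSlope (hrun : IsRun F ρ σ ϑlo ϑhi x d α B μ ϑ)
    (hF : ContDiff ℝ 1 F) (hm : 0 < m) (hϑ : 0 < ϑlo) (hρ : 0 < ρ) (hσ : σ < 1)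
    (hbdd : Bornology.IsBounded (levelSet F (x 0))) {L : ℝ}
    (hL : ∀ k j, ‖grad F j (x (k + 1)) - grad F j (x k)‖ ≤ L * ‖x (k + 1) - x k‖) :
    Tendsto (fun k => maxSlope F (x k) (d k) ^ 2 / ‖d k‖ ^ 2) atTop (𝓝 0) := by
  obtain ⟨c, hc⟩ := hrun.tendsto_values hF hm hϑ hρ hbdd ⟨0, hm⟩
  have hlim : Tendsto (fun k => L / (ρ * (1 - σ)) * (F (x k) ⟨0, hm⟩ - F (x (k + 1)) ⟨0, hm⟩))
      atTop (𝓝 0) := by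
    have := (hc.sub (hc.comp (tendsto_add_atTop_nat 1))).const_mul (L / (ρ * (1 - σ)))
    simpa using this
  refine squeeze_zero (fun k => by positivity) (fun k => ?_) hlim
  have h := hL k
  rw [hrun.next, add_sub_cancel_left] at h
  rw [hrun.next]
  exact sq_maxSlope_le hm hρ hσ (hrun.step_pos k) (hrun.direction_ne_zero hF hm hϑ k)
    (maxSlope_neg hF hm (hrun.posDef hF hm hϑ k) (hrun.not_critical k) (hrun.direction k))
    (hrun.wolfe k) h _

/-- Otherwise a subsequence of the pairs `(x k, μ k)` converges to some `(z, ν)` at which a convex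
combination of gradients vanishes, making the cluster point `z` critical. -/
lemma IsRun.exists_eventually_le_norm (hrun : IsRun F ρ σ ϑlo ϑhi x d α B μ ϑ)
    (hF : ContDiff ℝ 1 F) (hm : 0 < m) (hϑ : 0 < ϑlo) (hρ : 0 < ρ)
    (hbdd : Bornology.IsBounded (levelSet F (x 0)))
    (hnc : ∀ z, MapClusterPt z atTop x → ¬ IsParetoCritical F z) :
    ∃ ε > 0, ∀ᶠ k in atTop, ε ≤ ‖∑ i, μ k i • grad F i (x k)‖ := by
  by_contra! hcon
  have hfr : ∀ i : ℕ, ∃ᶠ k in atTop, ‖∑ j, μ k j • grad F j (x k)‖ < 1 / ((i : ℝ) + 1) := by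
    intro i
    simpa only [not_eventually, not_le] using hcon _ (Nat.one_div_pos_of_nat (α := ℝ) (n := i))
  obtain ⟨φ, hφ, hlt⟩ := extraction_forall_of_frequently hfr
  obtain ⟨⟨z, ν⟩, hzν, ψ, hψ, hlim⟩ :=
    ((isCompact_levelSet hF hbdd).prod (isCompact_stdSimplex ℝ (Fin m))).tendsto_subseq
      (x := fun i => (x (φ i), μ (φ i)))
      (fun i => ⟨hrun.mem_levelSet hF hm hϑ hρ _, hrun.simplex _⟩)
  have hz : Tendsto (fun i => x (φ (ψ i))) atTop (𝓝 z) := (continuous_fst.tendsto (z, ν)).comp hlim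
  have hν : Tendsto (fun i => μ (φ (ψ i))) atTop (𝓝 ν) := (continuous_snd.tendsto (z, ν)).comp hlim
  have h0 : Tendsto (fun i => ‖∑ j, μ (φ (ψ i)) j • grad F j (x (φ (ψ i)))‖) atTop (𝓝 0) :=
    squeeze_zero (fun _ => norm_nonneg _) (fun i => (hlt (ψ i)).le)
      ((tendsto_one_div_add_atTop_nhds_zero_nat (𝕜 := ℝ)).comp hψ.tendsto_atTop)
  have h1 : Tendsto (fun i => ‖∑ j, μ (φ (ψ i)) j • grad F j (x (φ (ψ i)))‖) atTop
      (𝓝 ‖∑ j, ν j • grad F j z‖) :=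
    (tendsto_finsetSum _ fun j _ => (tendsto_pi_nhds.1 hν j).smul
      (((continuous_grad hF j).tendsto z).comp hz)).norm
  have hcl : MapClusterPt z atTop x :=
    (Tendsto.mapClusterPt hz).of_comp (φ := φ ∘ ψ) (hφ.comp hψ).tendsto_atTop
  exact sum_smul_grad_ne_zero hF (hnc z hcl) hzν.2 (norm_eq_zero.1 (tendsto_nhds_unique h1 h0))

lemma IsRun.exists_frequently_angleDefect_le (hrun : IsRun F ρ σ ϑlo ϑhi x d α B μ ϑ)
    (hF : ContDiff ℝ 1 F) (hm : 0 < m) (hϑ : 0 < ϑlo) (hρ : 0 < ρ)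
    (hbdd : Bornology.IsBounded (levelSet F (x 0))) {L : ℝ}
    (hL : ∀ k j, ‖grad F j (x (k + 1)) - grad F j (x k)‖ ≤ L * ‖x (k + 1) - x k‖) {ε : ℝ}
    (hε : 0 < ε) (hle : ∀ᶠ k in atTop, ε ≤ ‖∑ i, μ k i • grad F i (x k)‖) :
    ∃ K, ∃ᶠ k in atTop, ∀ j, angleDefect (B k j) (d k).ofLp ≤ K := by
  have hPD := hrun.posDef hF hm hϑ
  have hd0 := hrun.direction_ne_zero hF hm hϑ
  obtain ⟨G, hG⟩ := ((isCompact_levelSet hF hbdd).prod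
    (isCompact_stdSimplex ℝ (Fin m))).bddAbove_image (continuous_norm_sum_smul_grad hF).continuousOn
  have hG' : ∀ k, ‖∑ i, μ k i • grad F i (x k)‖ ≤ G := fun k =>
    hG ⟨(x k, μ k), ⟨hrun.mem_levelSet hF hm hϑ hρ k, hrun.simplex k⟩, rfl⟩
  set c := ϑlo * ε with hc
  have hc0 : 0 < c := mul_pos hϑ hε
  -- Chosen so that `‖γ‖² ≤ (2L + ϑhi G)²‖s‖² = C (c‖s‖²) ≤ C γᵀ s`.
  set C := (2 * L + ϑhi * G) ^ 2 / c with hC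
  -- Summing over `j` yields one infinite set of indices `k` serving all objectives; separate
  -- arguments could give sets without common elements.
  let ψ : ℕ → ℝ := fun k => ∑ j, ((B k j).trace - Real.log (B k j).det)
  let f : ℕ → ℝ := fun k => ∑ j, angleDefect (B k j) (d k).ofLp
  have hψ : ∀ k, 0 ≤ ψ k := fun k =>
    Finset.sum_nonneg fun j _ => sub_nonneg.2 (log_det_le_trace (hPD k j))
  have hrec : ∀ᶠ k in atTop, ψ (k + 1) ≤ ψ k + m * (C - Real.log c) - f k := by
    filter_upwards [hle] with k hk
    have hs := hrun.step_ne_zero_of_posDef hF hm (hPD k)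
    have hs' : (x (k + 1) - x k).ofLp ≠ 0 := (WithLp.ofLp_eq_zero 2).not.2 hs
    have hθ := hrun.factor k
    have hθ0 : 0 < ϑ k := hϑ.trans hθ.1
    have hj : ∀ j, (B (k + 1) j).trace - Real.log (B (k + 1) j).det ≤
        ((B k j).trace - Real.log (B k j).det) + (C - Real.log c)
          - angleDefect (B k j) (d k).ofLp := by
      intro j
      have hlow : c * ‖x (k + 1) - x k‖ ^ 2 ≤
          inner ℝ (gam F (μ k) (ϑ k) (x k) (x (k + 1)) j) (x (k + 1) - x k) := by
        refine le_trans ?_ (le_inner_gam hs (μ k) (ϑ k) j)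
        gcongr
        exact mul_le_mul hθ.1.le hk hε.le hθ0.le
      have hup : ‖gam F (μ k) (ϑ k) (x k) (x (k + 1)) j‖ ≤
          (2 * L + ϑhi * G) * ‖x (k + 1) - x k‖ := by
        refine (norm_gam_le hs (μ k) hθ0.le (hL k j)).trans ?_
        gcongr
        · exact hθ0.le.trans hθ.2.le
        · exact hθ.2.le
        · exact hG' k
      have hang : angleDefect (B k j) (x (k + 1) - x k).ofLp =
          angleDefect (B k j) (d k).ofLp := by
        rw [hrun.next, add_sub_cancel_left, WithLp.ofLp_smul,
          angleDefect_smul _ _ (hrun.step_pos k).ne']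
      rw [hrun.update, ← hang]
      refine trace_sub_log_det_bfgsUpdate_le (hPD k j) hs' hc0 ?_ ?_
      · rwa [dotProduct_self_eq_norm_sq, ← inner_eq_dotProduct]
      · rw [dotProduct_self_eq_norm_sq, ← inner_eq_dotProduct]
        calc _ ≤ ((2 * L + ϑhi * G) * ‖x (k + 1) - x k‖) ^ 2 := by gcongr
          _ = C * (c * ‖x (k + 1) - x k‖ ^ 2) := by
            rw [hC]
            field_simp
          _ ≤ _ := by gcongr
    calc ψ (k + 1) ≤ ∑ j, (((B k j).trace - Real.log (B k j).det) + (C - Real.log c)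
          - angleDefect (B k j) (d k).ofLp) := Finset.sum_le_sum fun j _ => hj j
      _ = ψ k + m * (C - Real.log c) - f k := by
        simp only [Finset.sum_sub_distrib, Finset.sum_add_distrib, ψ, f]
        simp [mul_sub]
  refine ⟨m * (C - Real.log c) + 1, (frequently_le_of_add_le hψ hrec).mono fun k hk j => ?_⟩
  refine le_trans ?_ hk
  exact Finset.single_le_sum
    (f := fun j => angleDefect (B k j) (d k).ofLp)
    (fun j _ => angleDefect_nonneg (hPD k j) (by simpa using hd0 k)) (Finset.mem_univ j)

lemma IsRun.exists_le_sq_maxSlope (hrun : IsRun F ρ σ ϑlo ϑhi x d α B μ ϑ)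
    (hF : ContDiff ℝ 1 F) (hm : 0 < m) (hϑ : 0 < ϑlo) (hρ : 0 < ρ)
    (hbdd : Bornology.IsBounded (levelSet F (x 0)))
    (hnc : ∀ z, MapClusterPt z atTop x → ¬ IsParetoCritical F z) {K : ℝ}
    (hK : ∃ᶠ k in atTop, ∀ j, angleDefect (B k j) (d k).ofLp ≤ K) :
    ∃ c > 0, ∃ H, ∃ᶠ k in atTop, c ≤ H * (maxSlope F (x k) (d k) ^ 2 / ‖d k‖ ^ 2) := by
  obtain ⟨φ, hφ, hφK⟩ := extraction_of_frequently_atTop hK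
  obtain ⟨z, -, ψ, hψ, hz⟩ := (isCompact_levelSet hF hbdd).tendsto_subseq
    (x := fun i => x (φ i)) (fun i => hrun.mem_levelSet hF hm hϑ hρ _)
  have hsub : Tendsto (φ ∘ ψ) atTop atTop := (hφ.comp hψ).tendsto_atTop
  have hcl : MapClusterPt z atTop x := (Tendsto.mapClusterPt hz).of_comp hsub
  obtain ⟨h, hh⟩ := (not_isParetoCritical_iff hF).1 (hnc z hcl)
  -- A uniform margin `δ` lets the descent direction `h` at `z` serve at all nearby iterates as
  -- well.
  have hδ : ∀ᶠ δ in 𝓝[>] (0 : ℝ), ∀ j, inner ℝ (grad F j z) h < -δ := by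
    refine eventually_all.2 fun j => nhdsWithin_le_nhds ?_
    exact continuousAt_const.eventually_lt continuous_neg.continuousAt (by simpa using hh j)
  obtain ⟨δ, hδ, hδ0⟩ := (hδ.and self_mem_nhdsWithin).exists
  have hδ0 : 0 < δ := hδ0
  have hev : ∀ᶠ i in atTop, ∀ j, inner ℝ (grad F j (x (φ (ψ i)))) h < -δ := by
    refine eventually_all.2 fun j => ?_
    have hc : Continuous fun y => inner ℝ (grad F j y) h :=
      (continuous_grad hF j).inner continuous_const
    exact ((hc.tendsto z).comp hz).eventually_lt_const (hδ j)
  refine ⟨δ ^ 2 * (Real.exp (-K) / 2) ^ 2, by positivity, ‖h‖ ^ 2 * (2 * K) ^ 2, ?_⟩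
  refine hsub.frequently (hev.mono fun i hi => ?_).frequently
  have hk := hφK (ψ i)
  simp only [Function.comp_apply]
  set k := φ (ψ i)
  have hPD := hrun.posDef hF hm hϑ k
  have hd : d k ≠ 0 := hrun.direction_ne_zero hF hm hϑ k
  have hd' : (d k).ofLp ≠ 0 := by simpa using hd
  have hdn : 0 < ‖d k‖ := norm_pos_iff.2 hd
  obtain ⟨j, hj⟩ := exists_nonneg_of_minimizer hm hPD (hrun.direction k) h
  have h1 : δ ≤ h.ofLp ⬝ᵥ (B k j *ᵥ (d k).ofLp) := by linarith [hi j]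
  -- Since `δ > 0`, this keeps `‖d k‖` away from zero.
  have h2 : δ ^ 2 ≤ ‖h‖ ^ 2 * (2 * K) ^ 2 * ‖d k‖ ^ 2 := by
    calc δ ^ 2 ≤ (h.ofLp ⬝ᵥ (B k j *ᵥ (d k).ofLp)) ^ 2 := by gcongr
      _ ≤ _ := sq_dotProduct_le _ _
      _ ≤ ‖h‖ ^ 2 * ((2 * K) ^ 2 * ‖d k‖ ^ 2) := by
        rw [dotProduct_self_eq_norm_sq, ← dotProduct_self_eq_norm_sq (d k)]
        gcongr
        exact mulVec_dotProduct_le_of_angleDefect_le (hPD j) hd' (hk j)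
      _ = _ := by ring
  have h3 : maxSlope F (x k) (d k) ≤ -(Real.exp (-K) * ‖d k‖ ^ 2 / 2) := by
    refine maxSlope_le hF hm hPD (hrun.not_critical k) (hrun.direction k) fun j => ?_
    rw [← dotProduct_self_eq_norm_sq]
    exact le_dotProduct_mulVec_of_angleDefect_le (hPD j) hd' (hk j)
  have h4 : (Real.exp (-K) / 2) ^ 2 * ‖d k‖ ^ 2 ≤
      maxSlope F (x k) (d k) ^ 2 / ‖d k‖ ^ 2 := by
    rw [le_div_iff₀ (by positivity)]
    calc _ = (Real.exp (-K) * ‖d k‖ ^ 2 / 2) ^ 2 := by ring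
      _ ≤ (-maxSlope F (x k) (d k)) ^ 2 := by
        gcongr
        linarith
      _ = _ := neg_sq _
  calc δ ^ 2 * (Real.exp (-K) / 2) ^ 2
      ≤ (‖h‖ ^ 2 * (2 * K) ^ 2 * ‖d k‖ ^ 2) * (Real.exp (-K) / 2) ^ 2 := by gcongr
    _ = ‖h‖ ^ 2 * (2 * K) ^ 2 * ((Real.exp (-K) / 2) ^ 2 * ‖d k‖ ^ 2) := by ring
    _ ≤ _ := by gcongr

lemma IsRun.exists_mapClusterPt_isParetoCritical (hrun : IsRun F ρ σ ϑlo ϑhi x d α B μ ϑ)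
    (hF : ContDiff ℝ 1 F) (hm : 0 < m) (hϑ : 0 < ϑlo) (hρ : 0 < ρ) (hσ : σ < 1)
    (hbdd : Bornology.IsBounded (levelSet F (x 0))) {L : ℝ}
    (hL : ∀ k j, ‖grad F j (x (k + 1)) - grad F j (x k)‖ ≤ L * ‖x (k + 1) - x k‖) :
    ∃ z, MapClusterPt z atTop x ∧ IsParetoCritical F z := by
  by_contra! hnc
  obtain ⟨ε, hε, hle⟩ := hrun.exists_eventually_le_norm hF hm hϑ hρ hbdd hnc
  obtain ⟨K, hK⟩ := hrun.exists_frequently_angleDefect_le hF hm hϑ hρ hbdd hL hε hle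
  obtain ⟨c, hc, H, hH⟩ := hrun.exists_le_sq_maxSlope hF hm hϑ hρ hbdd hnc hK
  have hlim := (hrun.tendsto_sq_maxSlope hF hm hϑ hρ hσ hbdd hL).const_mul H
  rw [mul_zero] at hlim
  exact hH ((hlim.eventually_lt_const hc).mono fun k hk => hk.not_ge)

lemma IsRun.values_eq_of_mapClusterPt (hrun : IsRun F ρ σ ϑlo ϑhi x d α B μ ϑ)
    (hF : ContDiff ℝ 1 F) (hm : 0 < m) (hϑ : 0 < ϑlo) (hρ : 0 < ρ)
    (hbdd : Bornology.IsBounded (levelSet F (x 0))) {y z : EuclideanSpace ℝ (Fin n)}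
    (hy : MapClusterPt y atTop x) (hz : MapClusterPt z atTop x) (j : Fin m) :
    F y j = F z j := by
  obtain ⟨c, hc⟩ := hrun.tendsto_values hF hm hϑ hρ hbdd j
  have key : ∀ w, MapClusterPt w atTop x → F w j = c := fun w hw => by
    have h := hw.continuousAt_comp (f := fun z => F z j)
      (contDiff_component hF j).continuous.continuousAt
    have h' : ClusterPt (F w j) (𝓝 c) := ClusterPt.mono h hc
    exact eq_of_nhds_neBot h'
  rw [key y hy, key z hz]

end Run

end MultiobjectiveBFGS

theorem mainTheorem4 {n m : ℕ} (hm : 0 < m)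
    (F : EuclideanSpace ℝ (Fin n) → EuclideanSpace ℝ (Fin m))
    (ρ σ ϑlo ϑhi : ℝ) (hρ : ρ ∈ Set.Ioo (0 : ℝ) (1 / 2)) (hσ : σ ∈ Set.Ioo ρ 1)
    (hϑlo : 0 < ϑlo) (hϑhi : ϑlo ≤ ϑhi)
    (x d : ℕ → EuclideanSpace ℝ (Fin n)) (α : ℕ → ℝ)
    (B : ℕ → Fin m → Matrix (Fin n) (Fin n) ℝ) (μ : ℕ → Fin m → ℝ) (ϑ : ℕ → ℝ)
    (hF : ContDiff ℝ 1 F)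
    (hbdd : Bornology.IsBounded (MultiobjectiveBFGS.levelSet F (x 0)))
    (hLip : ∃ (L : NNReal) (N : Set (EuclideanSpace ℝ (Fin n))), IsOpen N ∧
      MultiobjectiveBFGS.levelSet F (x 0) ⊆ N ∧
      ∀ j, LipschitzOnWith L (MultiobjectiveBFGS.grad F j) N)
    (hconv : ∀ j, StrictConvexOn ℝ Set.univ (fun z => F z j))
    (hrun : MultiobjectiveBFGS.IsRun F ρ σ ϑlo ϑhi x d α B μ ϑ) :
    ∃ xstar, MultiobjectiveBFGS.IsParetoOptimal F xstar ∧ Tendsto x atTop (𝓝 xstar) := by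
  obtain ⟨L, N, -, hsub, hLip⟩ := hLip
  have hmem := hrun.mem_levelSet hF hm hϑlo hρ.1
  obtain ⟨z, hz, hcrit⟩ := hrun.exists_mapClusterPt_isParetoCritical hF hm hϑlo hρ.1 hσ.2 hbdd
    (L := L) fun k j => (hLip j).norm_sub_le (hsub (hmem (k + 1))) (hsub (hmem k))
  have hopt := MultiobjectiveBFGS.isParetoOptimal_of_isParetoCritical hF hconv hcrit
  refine ⟨z, hopt, ?_⟩
  -- Any cluster point `y` has the same value as the Pareto optimal `z`, hence equals it.
  refine (MultiobjectiveBFGS.isCompact_levelSet hF hbdd).tendsto_nhds_of_unique_mapClusterPt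
    (Eventually.of_forall hmem) fun y _ hy => ?_
  exact MultiobjectiveBFGS.eq_of_isParetoOptimal hm hconv hopt fun j =>
    (hrun.values_eq_of_mapClusterPt hF hm hϑlo hρ.1 hbdd hy hz j).le
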